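/- Let $n \ge 0$ be an integer and let $f$ be a symmetric function on $n$-bit strings with values in an arbitrary set $Y$, i.e. $f(x)$ depends only on the Hamming weight $|x|$; write $f(j)$ for the value of $f$ on strings of weight $j$. Suppose that $f(k+1) \neq f(k)$ for some integer $k$ with $0 \le k < \lfloor n/2 \rfloor$. Consider any procedure that is given a single copy of the $n$-qubit state $\sigma(U^{\otimes n}|x\rangle)$ and outputs an element of $Y$, that is, any quantum measurement (POVM) $(E_y)_{y \in Y}$ on $n$ qubits; here $x$ is an $n$-bit string with $|x| \le \lfloor n/2 \rfloor$, $U$ is a single-qubit unitary and $\sigma$ is a permutation of the $n$ qubits, all unknown to the procedure. Then the procedure computes $f(x)$ with probability at most $$1 - \frac{k+1}{2(n-k)}$$ in the worst case: there are an $n$-bit string $x$ with $|x| \le \lfloor n/2 \rfloor$, a unitary $U \in U(2)$ and a permutation $\sigma \in S_n$ such that, given $\sigma(U^{\otimes n}|x\rangle)$, the procedure outputs $f(x)$ with probability at most $1 - \frac{k+1}{2(n-k)}$. -/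

import Mathlib

open scoped ComplexOrder

/-- The computational basis state `|x⟩` of `n` qubits, as a vector of the state space
`(ℂ²)^{⊗n}`; vectors of this space are written in coordinates with respect to the computational
basis, which is indexed by the bit strings of length `n`. -/
def basisKet {n : ℕ} (x : Fin n → Fin 2) : (Fin n → Fin 2) → ℂ :=
  Pi.single x 1

/-- The matrix of the operator `U^{⊗n}` on `n` qubits, for a one-qubit operator `U`. -/
def tensorPow (n : ℕ) (U : Matrix (Fin 2) (Fin 2) ℂ) :
    Matrix (Fin n → Fin 2) (Fin n → Fin 2) ℂ :=
  Matrix.of fun a b => ∏ i, U (a i) (b i)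

/-- The matrix of the operator that permutes the `n` qubits by `σ`; it sends the basis vector
`|b₁ ⋯ bₙ⟩` to the basis vector whose `i`-th bit is the bit of `b` at position `σ⁻¹ i`. -/
def qubitPerm {n : ℕ} (σ : Equiv.Perm (Fin n)) :
    Matrix (Fin n → Fin 2) (Fin n → Fin 2) ℂ :=
  Matrix.of fun a b => if a = b ∘ σ.symm then 1 else 0

/-- The scrambled state `σ(U^{⊗n}|x⟩)`. -/
noncomputable def scrambledState {n : ℕ} (σ : Equiv.Perm (Fin n))
    (U : Matrix.unitaryGroup (Fin 2) ℂ) (x : Fin n → Fin 2) : (Fin n → Fin 2) → ℂ :=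
  Matrix.mulVec (qubitPerm σ)
    (Matrix.mulVec (tensorPow n (U : Matrix (Fin 2) (Fin 2) ℂ)) (basisKet x))

/-- A procedure which receives one copy of a state of `n` qubits and returns an element of `Y`: a
general quantum measurement (POVM) with outcomes in `Y`. Ancillas, joint unitaries, intermediate
measurements, internal randomness and classical post-processing are all covered, since the output
distribution of any such protocol is given by a POVM. -/
structure MeasurementProcedure (n : ℕ) (Y : Type*) where
  /-- the effect that belongs to an outcome -/
  effect : Y → Matrix (Fin n → Fin 2) (Fin n → Fin 2) ℂ
  posSemidef : ∀ y, (effect y).PosSemidef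
  hasSum_effect : HasSum effect 1

/-- The probability `⟨ψ|E_y|ψ⟩` that the procedure returns `y` when it is given the state `ψ`. -/
noncomputable def MeasurementProcedure.prob {n : ℕ} {Y : Type*} (M : MeasurementProcedure n Y)
    (ψ : (Fin n → Fin 2) → ℂ) (y : Y) : ℝ :=
  (dotProduct (star ψ) (Matrix.mulVec (M.effect y) ψ)).re

/-!
Write `W k` for the span of the basis states of weight `k`, `E` for the effect that belongs to the
outcome `F k`, and `r = (k + 1) / (n - k)`, the ratio of `dim (W k)` to `dim (W (k + 1))`. Averaging
`U^{⊗n} E (U^{⊗n})†` over the Haar measure of `U(2)` gives a positive semidefinite operator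
`twirl E`. Its diagonal entry at `x` is the probability that the procedure returns `F k` on the
state `U^{⊗n}|x⟩` for a Haar random `U`.

By invariance of the Haar measure `twirl E` commutes with all `U^{⊗n}`, hence, by differentiating
along one-parameter groups, with the collective raising operator `S = ∑ i, |1⟩⟨0|_i`
(`raising_commute`). For `2 * k < n` the map `S : W k → W (k + 1)` is injective, since on `W k` the
commutation relations of `sl₂` give `S† S = S S† + (n - 2 k) > 0`
(`eq_zero_of_raising_mulVec_eq_zero`). So `S` intertwines the blocks of `twirl E` on `W k` and
`W (k + 1)`: the first block is similar to the restriction of the second to an invariant subspace,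
and the trace of the first is at most that of the second (`trace_le_of_intertwining`).

Suppose now that the procedure always succeeds with probability above `c = 1 - r / 2`. On weight `k`
the diagonal entries of `twirl E` are at least `c`; on weight `k + 1` they are at most
`1 - c = r / 2`, because the effects of `F k` and `F (k + 1)` add up to at most the identity.
Comparing traces gives `dim (W k) * c ≤ dim (W (k + 1)) * r / 2 = dim (W k) / 2`, so `c ≤ 1 / 2`,
whereas `c > 1 / 2` because `k + 1 < n - k`. No permutation of the qubits is needed, since the traces
already run over all strings of a given weight.
-/

open Matrix MeasureTheory

/-! ### Traces of intertwined positive matrices -/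

/-- If an injective `T` intertwines `A` with a positive semidefinite `B`, then `tr A ≤ tr B`: with
`Q = T (T† T)⁻¹ T†` the orthogonal projection onto the range of `T`, `tr A = tr (B Q)`, and
`tr (B (1 - Q)) = tr ((1 - Q) B (1 - Q)) ≥ 0`. -/
theorem trace_le_of_intertwining {ι κ : Type*} [Fintype ι] [Fintype κ] [DecidableEq ι]
    [DecidableEq κ] {A : Matrix ι ι ℂ} {B : Matrix κ κ ℂ} {T : Matrix κ ι ℂ}
    (hB : B.PosSemidef) (hT : Function.Injective T.mulVec) (h : B * T = T * A) :
    A.trace ≤ B.trace := by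
  set G := Tᴴ * T with hG
  have hGpos : G.PosDef := PosDef.conjTranspose_mul_self T hT
  have hu : IsUnit G.det := (isUnit_iff_isUnit_det _).1 hGpos.isUnit
  have hGG : G⁻¹ * G = 1 := nonsing_inv_mul _ hu
  set Q := T * G⁻¹ * Tᴴ with hQ
  have hQH : Qᴴ = Q := by
    have : (G⁻¹)ᴴ = G⁻¹ := by rw [conjTranspose_nonsing_inv, hGpos.1]
    simp only [hQ, conjTranspose_mul, conjTranspose_conjTranspose, this, Matrix.mul_assoc]
  have hQQ : Q * Q = Q := by
    calc Q * Q = T * (G⁻¹ * G) * G⁻¹ * Tᴴ := by simp only [hQ, hG, Matrix.mul_assoc]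
      _ = Q := by rw [hGG, Matrix.mul_one]
  have hA : A.trace = (B * Q).trace := by
    calc A.trace = (G⁻¹ * G * A).trace := by rw [hGG, Matrix.one_mul]
      _ = (G⁻¹ * Tᴴ * (T * A)).trace := by simp only [hG, Matrix.mul_assoc]
      _ = (G⁻¹ * Tᴴ * (B * T)).trace := by rw [h]
      _ = (B * T * (G⁻¹ * Tᴴ)).trace := Matrix.trace_mul_comm _ _
      _ = (B * Q).trace := by simp only [hQ, Matrix.mul_assoc]
  have hpos := (hB.mul_mul_conjTranspose_same (1 - Q)).trace_nonneg
  have hc : ((1 - Q) * B * (1 - Q)ᴴ).trace = B.trace - (B * Q).trace := by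
    rw [conjTranspose_sub, conjTranspose_one, hQH, Matrix.trace_mul_comm, ← Matrix.mul_assoc]
    have : (1 - Q) * (1 - Q) = 1 - Q := by
      simp [Matrix.mul_sub, Matrix.sub_mul, hQQ]
    rw [this, Matrix.trace_mul_comm, Matrix.mul_sub, Matrix.mul_one, trace_sub]
  rw [hc] at hpos
  rw [hA]
  exact sub_nonneg.1 hpos

/-! ### Tensor powers of one-qubit operators -/

theorem tensorPow_apply {n : ℕ} (U : Matrix (Fin 2) (Fin 2) ℂ) (a b : Fin n → Fin 2) :
    tensorPow n U a b = ∏ i, U (a i) (b i) := rfl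

theorem tensorPow_mul {n : ℕ} (U V : Matrix (Fin 2) (Fin 2) ℂ) :
    tensorPow n (U * V) = tensorPow n U * tensorPow n V := by
  ext a b
  simp only [tensorPow_apply, Matrix.mul_apply, Finset.prod_univ_sum, Fintype.piFinset_univ,
    Finset.prod_mul_distrib]

theorem tensorPow_one {n : ℕ} : tensorPow n 1 = 1 := by
  ext a b
  rw [tensorPow_apply, Matrix.one_apply]
  split_ifs with h
  · subst h
    exact Finset.prod_eq_one fun i _ => Matrix.one_apply_eq (a i)
  · obtain ⟨i, hi⟩ := Function.ne_iff.1 h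
    exact Finset.prod_eq_zero (Finset.mem_univ i) (Matrix.one_apply_ne hi)

theorem tensorPow_conjTranspose {n : ℕ} (U : Matrix (Fin 2) (Fin 2) ℂ) :
    tensorPow n Uᴴ = (tensorPow n U)ᴴ := by
  ext a b
  simp [tensorPow_apply, conjTranspose_apply]

theorem tensorPow_conjTranspose_mul_self {n : ℕ} (U : unitaryGroup (Fin 2) ℂ) :
    (tensorPow n (U : Matrix (Fin 2) (Fin 2) ℂ))ᴴ * tensorPow n (U : Matrix (Fin 2) (Fin 2) ℂ)
      = 1 := by
  rw [← tensorPow_conjTranspose, ← tensorPow_mul, ← star_eq_conjTranspose,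
    mem_unitaryGroup_iff'.1 U.2, tensorPow_one]

theorem continuous_tensorPow (n : ℕ) :
    Continuous fun U : unitaryGroup (Fin 2) ℂ => tensorPow n (U : Matrix (Fin 2) (Fin 2) ℂ) := by
  refine continuous_matrix fun a b => ?_
  simp only [tensorPow_apply]
  exact continuous_finsetProd _ fun i _ => continuous_subtype_val.matrix_elem _ _

/-! ### Collective one-qubit operators and the ladder operators -/

/-- The operator `∑ i, X_i` on `n` qubits, where `X_i` acts as `X` on qubit `i` and as the identity
on the others. It is the derivative of `U ↦ U^{⊗n}` at the identity in the direction `X`. -/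
def collective (n : ℕ) (X : Matrix (Fin 2) (Fin 2) ℂ) :
    Matrix (Fin n → Fin 2) (Fin n → Fin 2) ℂ :=
  Matrix.of fun a b => ∑ i, (∏ j ∈ Finset.univ.erase i,
    (1 : Matrix (Fin 2) (Fin 2) ℂ) (a j) (b j)) * X (a i) (b i)

theorem collective_apply {n : ℕ} (X : Matrix (Fin 2) (Fin 2) ℂ) (a b : Fin n → Fin 2) :
    collective n X a b = ∑ i, (∏ j ∈ Finset.univ.erase i,
      (1 : Matrix (Fin 2) (Fin 2) ℂ) (a j) (b j)) * X (a i) (b i) := rfl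

theorem collective_conjTranspose {n : ℕ} (X : Matrix (Fin 2) (Fin 2) ℂ) :
    (collective n X)ᴴ = collective n Xᴴ := by
  ext a b
  simp [collective_apply, conjTranspose_apply, Matrix.one_apply, eq_comm, apply_ite]

theorem collective_add {n : ℕ} (X Y : Matrix (Fin 2) (Fin 2) ℂ) :
    collective n (X + Y) = collective n X + collective n Y := by
  ext a b
  simp [collective_apply, mul_add, Finset.sum_add_distrib]

theorem collective_smul {n : ℕ} (z : ℂ) (X : Matrix (Fin 2) (Fin 2) ℂ) :
    collective n (z • X) = z • collective n X := by
  ext a b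
  simp [collective_apply, Finset.mul_sum, mul_left_comm]

/-- The matrix entry of the action of `X` on qubit `i`, in a form that makes the sum over `b`
collapse: only the strings `b` that agree with `a` away from `i` contribute. -/
theorem prod_erase_one_apply_mul {n : ℕ} (X : Matrix (Fin 2) (Fin 2) ℂ) (a b : Fin n → Fin 2)
    (i : Fin n) :
    (∏ j ∈ Finset.univ.erase i, (1 : Matrix (Fin 2) (Fin 2) ℂ) (a j) (b j)) * X (a i) (b i)
      = ∑ c, if b = Function.update a i c then X (a i) c else 0 := by
  by_cases h : b = Function.update a i (b i)
  · rw [Finset.prod_eq_one, one_mul, Finset.sum_eq_single (b i)]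
    · rw [if_pos h]
    · intro c _ hc
      rw [if_neg]
      intro h'
      exact hc (by rw [h']; simp)
    · simp
    · intro j hj
      have := congrFun h j
      rw [Function.update_of_ne (Finset.ne_of_mem_erase hj)] at this
      rw [this, Matrix.one_apply_eq]
  · rw [Finset.sum_eq_zero]
    · have : ∃ j, j ≠ i ∧ a j ≠ b j := by
        by_contra! hcon
        apply h
        funext j
        by_cases hj : j = i
        · subst hj; simp
        · rw [Function.update_of_ne hj, hcon j hj]
      obtain ⟨j, hj, hab⟩ := this
      have h0 : (1 : Matrix (Fin 2) (Fin 2) ℂ) (a j) (b j) = 0 := Matrix.one_apply_ne hab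
      refine mul_eq_zero_of_left (Finset.prod_eq_zero (i := j) ?_ h0) _
      exact Finset.mem_erase.2 ⟨hj, Finset.mem_univ j⟩
    · intro c _
      rw [if_neg]
      intro h'
      apply h
      have : b i = c := by rw [h']; simp
      rw [this]; exact h'

theorem collective_mulVec {n : ℕ} (X : Matrix (Fin 2) (Fin 2) ℂ) (v : (Fin n → Fin 2) → ℂ)
    (a : Fin n → Fin 2) :
    (collective n X *ᵥ v) a = ∑ i, ∑ c, X (a i) c * v (Function.update a i c) := by
  simp only [mulVec, dotProduct, collective_apply, prod_erase_one_apply_mul, Finset.sum_mul]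
  rw [Finset.sum_comm]
  refine Finset.sum_congr rfl fun i _ => ?_
  rw [Finset.sum_comm]
  refine Finset.sum_congr rfl fun c _ => ?_
  simp

/-- `X ↦ collective n X` preserves commutators, as operators on different qubits commute. -/
theorem collective_commutator_mulVec {n : ℕ} (X Y : Matrix (Fin 2) (Fin 2) ℂ)
    (v : (Fin n → Fin 2) → ℂ) :
    collective n X *ᵥ (collective n Y *ᵥ v) - collective n Y *ᵥ (collective n X *ᵥ v)
      = collective n (X * Y - Y * X) *ᵥ v := by
  funext a
  have key : ∀ X Y : Matrix (Fin 2) (Fin 2) ℂ,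
      (collective n X *ᵥ (collective n Y *ᵥ v)) a = ∑ i, ∑ j, ∑ c, ∑ d,
        X (a i) c * (Y (Function.update a i c j) d
          * v (Function.update (Function.update a i c) j d)) := by
    intro X Y
    simp only [collective_mulVec, Finset.mul_sum]
    exact Finset.sum_congr rfl fun i _ => Finset.sum_comm
  rw [Pi.sub_apply, key X Y, key Y X, Finset.sum_comm (γ := Fin n) (s := Finset.univ)
    (f := fun i j => ∑ c, ∑ d, Y (a i) c * (X (Function.update a i c j) d
          * v (Function.update (Function.update a i c) j d))),
    ← Finset.sum_sub_distrib, collective_mulVec]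
  refine Finset.sum_congr rfl fun i _ => ?_
  rw [← Finset.sum_sub_distrib, Finset.sum_eq_single i]
  · simp only [Function.update_self, Function.update_idem, Matrix.sub_apply, Matrix.mul_apply,
      sub_mul, Finset.sum_sub_distrib, Finset.sum_mul]
    congr 1
    · rw [Finset.sum_comm]
      simp only [mul_assoc]
    · rw [Finset.sum_comm]
      simp only [mul_assoc]
  · intro j _ hj
    rw [sub_eq_zero, Finset.sum_comm]
    refine Finset.sum_congr rfl fun c _ => Finset.sum_congr rfl fun d _ => ?_
    rw [Function.update_of_ne hj, Function.update_of_ne hj.symm, Function.update_comm hj]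
    ring
  · simp

/-- The collective raising operator `∑ i, |1⟩⟨0|_i` on `n` qubits. -/
def raising (n : ℕ) : Matrix (Fin n → Fin 2) (Fin n → Fin 2) ℂ :=
  collective n (Matrix.single 1 0 1)

theorem hammingNorm_update_one {n : ℕ} (a : Fin n → Fin 2) (i : Fin n) (h : a i = 0) :
    hammingNorm (Function.update a i 1) = hammingNorm a + 1 := by
  unfold hammingNorm
  have : (Finset.univ.filter fun j => Function.update a i 1 j ≠ 0)
      = insert i (Finset.univ.filter fun j => a j ≠ 0) := by
    ext j
    by_cases hj : j = i
    · subst hj; simp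
    · simp [hj]
  rw [this, Finset.card_insert_of_notMem (by simp [h])]

theorem raising_apply_eq_zero {n : ℕ} {a b : Fin n → Fin 2}
    (h : hammingNorm a ≠ hammingNorm b + 1) : raising n a b = 0 := by
  rw [raising, collective_apply]
  refine Finset.sum_eq_zero fun i _ => ?_
  rw [prod_erase_one_apply_mul]
  refine Finset.sum_eq_zero fun c _ => ?_
  split_ifs with hb
  · rw [Matrix.single_apply, if_neg]
    rintro ⟨h1, rfl⟩
    apply h
    rw [← hammingNorm_update_one b i (by rw [hb]; simp), hb, Function.update_idem, h1,
      Function.update_eq_self]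
  · rfl

/-- The `sl₂` relation `S† S - S S† = ∑ i, Z_i` for the raising operator `S`; the right-hand side
is diagonal, with value `n - 2 |a|` at `a`. -/
theorem lowering_raising_mulVec {n : ℕ} (v : (Fin n → Fin 2) → ℂ) (a : Fin n → Fin 2) :
    ((raising n)ᴴ *ᵥ (raising n *ᵥ v)) a
      = (raising n *ᵥ ((raising n)ᴴ *ᵥ v)) a + ((n : ℂ) - 2 * hammingNorm a) * v a := by
  have hZ : (single 1 0 1 : Matrix (Fin 2) (Fin 2) ℂ)ᴴ * single 1 0 1
      - single 1 0 1 * (single 1 0 1 : Matrix (Fin 2) (Fin 2) ℂ)ᴴ = diagonal ![1, -1] := by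
    ext i j
    fin_cases i <;> fin_cases j <;> simp
  rw [← sub_eq_iff_eq_add', raising, collective_conjTranspose, ← Pi.sub_apply,
    collective_commutator_mulVec, collective_mulVec, hZ]
  have h : ∀ i, ∑ c, (diagonal ![1, -1] : Matrix (Fin 2) (Fin 2) ℂ) (a i) c
      * v (Function.update a i c) = (1 - 2 * if a i ≠ 0 then 1 else 0) * v a := by
    intro i
    rw [Finset.sum_eq_single (a i) (fun c _ hc => by rw [diagonal_apply_ne _ hc.symm, zero_mul])
      (by simp), Function.update_eq_self, diagonal_apply_eq]
    obtain h2 | h2 : a i = 0 ∨ a i = 1 := by omega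
    · simp [h2]
    · rw [h2]
      norm_num
  rw [Finset.sum_congr rfl fun i _ => h i, ← Finset.sum_mul, Finset.sum_sub_distrib,
    ← Finset.mul_sum, Finset.sum_boole]
  simp [hammingNorm]

/-- The raising operator is injective on the vectors of weight `k < n / 2`: if it kills `v`, then
`‖S† v‖² + (n - 2 k) ‖v‖² = 0`. -/
theorem eq_zero_of_raising_mulVec_eq_zero {n k : ℕ} (hk : 2 * k < n) {v : (Fin n → Fin 2) → ℂ}
    (hv : ∀ a, hammingNorm a ≠ k → v a = 0) (h : raising n *ᵥ v = 0) : v = 0 := by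
  have h1 : raising n *ᵥ ((raising n)ᴴ *ᵥ v) + ((n : ℂ) - 2 * k) • v = 0 := by
    funext a
    have := lowering_raising_mulVec v a
    rw [h, mulVec_zero] at this
    rw [Pi.add_apply, Pi.smul_apply, smul_eq_mul, this]
    by_cases ha : hammingNorm a = k
    · rw [ha]
    · simp [hv a ha]
  have h2 : star v ⬝ᵥ (raising n *ᵥ ((raising n)ᴴ *ᵥ v)) + ((n : ℂ) - 2 * k) * (star v ⬝ᵥ v)
      = 0 := by
    have := congrArg (fun w => star v ⬝ᵥ w) h1
    simpa [dotProduct_add, dotProduct_smul] using this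
  have h3 : 0 ≤ star v ⬝ᵥ (raising n *ᵥ ((raising n)ᴴ *ᵥ v)) := by
    have := (posSemidef_self_mul_conjTranspose (raising n)).dotProduct_mulVec_nonneg v
    rwa [← mulVec_mulVec] at this
  have h4 : (0 : ℂ) < (n : ℂ) - 2 * k := by
    rw [sub_pos]; exact_mod_cast hk
  have h5 : 0 ≤ star v ⬝ᵥ v := dotProduct_star_self_nonneg v
  have h6 := (add_eq_zero_iff_of_nonneg h3 (mul_nonneg h4.le h5)).1 h2
  exact dotProduct_star_self_eq_zero.1 ((mul_eq_zero.1 h6.2).resolve_left h4.ne')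

/-! ### From commuting with the group to commuting with the Lie algebra -/

/-- For a skew-Hermitian `X` with `X² = -1`, the derivative at `θ = 0` of the relation
`R(θ)^{⊗n} B = B R(θ)^{⊗n}`, where `R(θ) = cos θ + sin θ X = exp (θ X)`. -/
theorem collective_commute_of_sq_eq_neg_one {n : ℕ} {B : Matrix (Fin n → Fin 2) (Fin n → Fin 2) ℂ}
    (hB : ∀ U : unitaryGroup (Fin 2) ℂ, tensorPow n (U : Matrix (Fin 2) (Fin 2) ℂ) * B
      = B * tensorPow n (U : Matrix (Fin 2) (Fin 2) ℂ))
    {X : Matrix (Fin 2) (Fin 2) ℂ} (hX : Xᴴ = -X) (hXX : X * X = -1) :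
    collective n X * B = B * collective n X := by
  set R : ℝ → Matrix (Fin 2) (Fin 2) ℂ :=
    fun θ => (Real.cos θ : ℂ) • 1 + (Real.sin θ : ℂ) • X with hR
  have hRU : ∀ θ, R θ ∈ unitaryGroup (Fin 2) ℂ := by
    intro θ
    have hcs : (Real.cos θ : ℂ) * Real.cos θ + (Real.sin θ : ℂ) * Real.sin θ = 1 := by
      norm_cast
      rw [← sq, ← sq, Real.cos_sq_add_sin_sq]
    have hs : star (R θ) = (Real.cos θ : ℂ) • 1 - (Real.sin θ : ℂ) • X := by
      rw [star_eq_conjTranspose, hR]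
      simp only [conjTranspose_add, conjTranspose_smul, conjTranspose_one, hX, Complex.star_def,
        Complex.conj_ofReal, smul_neg, sub_eq_add_neg]
    rw [mem_unitaryGroup_iff, hs]
    simp only [hR, Matrix.add_mul, Matrix.mul_sub, Matrix.smul_mul, Matrix.mul_smul,
      Matrix.one_mul, Matrix.mul_one, hXX]
    calc _ = ((Real.cos θ : ℂ) * Real.cos θ + (Real.sin θ : ℂ) * Real.sin θ) •
          (1 : Matrix (Fin 2) (Fin 2) ℂ) := by module
      _ = 1 := by rw [hcs, one_smul]
  have hR0 : R 0 = 1 := by simp [hR]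
  have hder : ∀ i j, HasDerivAt (fun θ => R θ i j) (X i j) 0 := by
    intro i j
    have hc := (Real.hasDerivAt_cos 0).ofReal_comp.mul_const ((1 : Matrix (Fin 2) (Fin 2) ℂ) i j)
    have hs := (Real.hasDerivAt_sin 0).ofReal_comp.mul_const (X i j)
    exact (hc.add hs).congr_deriv (by simp)
  have hT : ∀ a b, HasDerivAt (fun θ => tensorPow n (R θ) a b) (collective n X a b) 0 := by
    intro a b
    refine (HasDerivAt.fun_finsetProd (u := Finset.univ) (x := (0 : ℝ))
      (f := fun (i : Fin n) θ => R θ (a i) (b i)) fun i _ => hder (a i) (b i)).congr_deriv ?_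
    simp only [hR0, smul_eq_mul, collective_apply]
  ext a b
  have h1 : HasDerivAt (fun θ => (tensorPow n (R θ) * B) a b) ((collective n X * B) a b) 0 := by
    simp only [Matrix.mul_apply]
    exact HasDerivAt.fun_sum fun c _ => (hT a c).mul_const _
  have h2 : HasDerivAt (fun θ => (B * tensorPow n (R θ)) a b) ((B * collective n X) a b) 0 := by
    simp only [Matrix.mul_apply]
    exact HasDerivAt.fun_sum fun c _ => (hT c b).const_mul _
  have h3 : (fun θ => (tensorPow n (R θ) * B) a b) = fun θ => (B * tensorPow n (R θ)) a b :=
    funext fun θ => congrFun (congrFun (hB ⟨R θ, hRU θ⟩) a) b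
  rw [h3] at h1
  exact h1.unique h2

/-- `|1⟩⟨0|` is a complex combination of two skew-Hermitian matrices with square `-1`. -/
theorem raising_commute {n : ℕ} {B : Matrix (Fin n → Fin 2) (Fin n → Fin 2) ℂ}
    (hB : ∀ U : unitaryGroup (Fin 2) ℂ, tensorPow n (U : Matrix (Fin 2) (Fin 2) ℂ) * B
      = B * tensorPow n (U : Matrix (Fin 2) (Fin 2) ℂ)) :
    raising n * B = B * raising n := by
  have hX := collective_commute_of_sq_eq_neg_one hB (X := !![0, -1; 1, 0])
    (by ext i j; fin_cases i <;> fin_cases j <;> simp)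
    (by ext i j; fin_cases i <;> fin_cases j <;> simp)
  have hY := collective_commute_of_sq_eq_neg_one hB (X := !![0, Complex.I; Complex.I, 0])
    (by ext i j; fin_cases i <;> fin_cases j <;> simp)
    (by ext i j; fin_cases i <;> fin_cases j <;> simp)
  have hS : (single 1 0 1 : Matrix (Fin 2) (Fin 2) ℂ) = (1 / 2 : ℂ) • !![0, -1; 1, 0]
      + (-Complex.I / 2) • !![0, Complex.I; Complex.I, 0] := by
    ext i j
    fin_cases i <;> fin_cases j <;> simp [div_mul_eq_mul_div]; norm_num
  rw [raising, hS, collective_add, collective_smul, collective_smul, Matrix.add_mul,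
    Matrix.mul_add, Matrix.smul_mul, Matrix.smul_mul, Matrix.mul_smul, Matrix.mul_smul, hX, hY]

/-! ### Weight blocks of operators that commute with collective rotations -/

/-- The diagonal block of an operator on `n` qubits on the span of the basis states of weight
`k`. -/
def weightBlock {n : ℕ} (k : ℕ) (A : Matrix (Fin n → Fin 2) (Fin n → Fin 2) ℂ) :
    Matrix {x : Fin n → Fin 2 // hammingNorm x = k} {x : Fin n → Fin 2 // hammingNorm x = k} ℂ :=
  A.submatrix Subtype.val Subtype.val

theorem sum_subtype_of_eq_zero {α : Type*} [Fintype α] {p : α → Prop} [DecidablePred p]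
    {f : α → ℂ} (h : ∀ a, ¬ p a → f a = 0) : ∑ a : {a // p a}, f a = ∑ a, f a := by
  rw [← Finset.sum_subtype (Finset.univ.filter p) (by simp) f]
  exact Finset.sum_filter_of_ne fun a _ ha => by_contra fun hp => ha (h a hp)

theorem trace_weightBlock_le_succ {n k : ℕ} (hk : 2 * k < n)
    {A : Matrix (Fin n → Fin 2) (Fin n → Fin 2) ℂ} (hA : A.PosSemidef)
    (h : raising n * A = A * raising n) :
    (weightBlock k A).trace ≤ (weightBlock (k + 1) A).trace := by
  set T : Matrix {x : Fin n → Fin 2 // hammingNorm x = k + 1}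
    {x : Fin n → Fin 2 // hammingNorm x = k} ℂ :=
    (raising n).submatrix Subtype.val Subtype.val with hT
  refine trace_le_of_intertwining (T := T) (hA.submatrix _) ?_ ?_
  · rw [← Matrix.coe_mulVecLin, ← LinearMap.ker_eq_bot, LinearMap.ker_eq_bot']
    intro w hw
    rw [Matrix.mulVecLin_apply] at hw
    set v : (Fin n → Fin 2) → ℂ := fun x => if h : hammingNorm x = k then w ⟨x, h⟩ else 0 with hv
    have hv0 : ∀ a, hammingNorm a ≠ k → v a = 0 := fun a ha => dif_neg ha
    have hvw : ∀ x : {x : Fin n → Fin 2 // hammingNorm x = k}, v x = w x :=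
      fun x => dif_pos x.2
    have hSv : raising n *ᵥ v = 0 := by
      funext a
      by_cases ha : hammingNorm a = k + 1
      · have := congrFun hw ⟨a, ha⟩
        rw [Pi.zero_apply] at this ⊢
        rw [← this]
        simp only [mulVec, dotProduct, hT, submatrix_apply, ← hvw]
        exact (sum_subtype_of_eq_zero (p := fun x : Fin n → Fin 2 => hammingNorm x = k)
          (f := fun x => raising n a x * v x) fun x hx => by rw [hv0 x hx, mul_zero]).symm
      · refine Finset.sum_eq_zero fun x _ => ?_
        by_cases hx : hammingNorm x = k
        · exact mul_eq_zero_of_left (raising_apply_eq_zero (by rwa [hx])) _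
        · exact mul_eq_zero_of_right _ (hv0 x hx)
    have := eq_zero_of_raising_mulVec_eq_zero hk hv0 hSv
    funext x
    rw [← hvw, this]
    rfl
  · ext ⟨a, ha⟩ ⟨b, hb⟩
    have h' := congrFun (congrFun h a) b
    simp only [Matrix.mul_apply] at h' ⊢
    simp only [weightBlock, hT, submatrix_apply]
    rw [sum_subtype_of_eq_zero (p := fun x : Fin n → Fin 2 => hammingNorm x = k + 1)
        (f := fun x => A a x * raising n x b),
      sum_subtype_of_eq_zero (p := fun x : Fin n → Fin 2 => hammingNorm x = k)
        (f := fun x => raising n a x * A x b), h']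
    · intro x hx
      rw [raising_apply_eq_zero, zero_mul]
      rw [ha]
      exact fun h => hx (Nat.succ_injective h).symm
    · intro x hx
      rw [raising_apply_eq_zero, mul_zero]
      rwa [hb]

theorem card_hammingNorm_eq (n k : ℕ) :
    Fintype.card {x : Fin n → Fin 2 // hammingNorm x = k} = n.choose k := by
  have hc := Finset.card_powersetCard k (Finset.univ : Finset (Fin n))
  rw [Finset.card_univ, Fintype.card_fin] at hc
  rw [Fintype.card_subtype, ← hc]
  refine Finset.card_bij' (fun x _ => Finset.univ.filter fun i => x i ≠ 0)
    (fun s _ i => if i ∈ s then 1 else 0) ?_ ?_ ?_ ?_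
  · intro x hx
    simpa [Finset.mem_powersetCard, hammingNorm] using hx
  · intro s hs
    simpa [Finset.mem_powersetCard, hammingNorm] using hs
  · intro x _
    funext i
    obtain h | h : x i = 0 ∨ x i = 1 := by omega
    all_goals simp [h]
  · intro s _
    ext i
    simp

/-! ### Averaging over the unitary group -/

theorem isCompact_unitaryGroup :
    IsCompact (unitaryGroup (Fin 2) ℂ : Set (Matrix (Fin 2) (Fin 2) ℂ)) := by
  have hcl : IsClosed (unitaryGroup (Fin 2) ℂ : Set (Matrix (Fin 2) (Fin 2) ℂ)) := by
    have : (unitaryGroup (Fin 2) ℂ : Set (Matrix (Fin 2) (Fin 2) ℂ)) = {U | U * star U = 1} := by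
      ext U
      exact mem_unitaryGroup_iff
    rw [this]
    exact isClosed_eq (by fun_prop) continuous_const
  have hK : IsCompact (Set.univ.pi fun _ : Fin 2 => Set.univ.pi fun _ : Fin 2 =>
      Metric.closedBall (0 : ℂ) 1) :=
    isCompact_univ_pi fun _ => isCompact_univ_pi fun _ => isCompact_closedBall _ _
  refine hK.of_isClosed_subset hcl ?_
  intro U hU i _ j _
  rw [mem_closedBall_zero_iff]
  exact entry_norm_bound_of_unitary hU i j

instance compactSpace_unitaryGroup : CompactSpace (unitaryGroup (Fin 2) ℂ) :=
  isCompact_iff_compactSpace.1 isCompact_unitaryGroup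

noncomputable instance measurableSpace_unitaryGroup : MeasurableSpace (unitaryGroup (Fin 2) ℂ) := borel _

instance borelSpace_unitaryGroup : BorelSpace (unitaryGroup (Fin 2) ℂ) := ⟨rfl⟩

/-- The Haar probability measure on `U(2)`. -/
noncomputable def haarU : Measure (unitaryGroup (Fin 2) ℂ) := Measure.haarMeasure ⊤

instance isProbabilityMeasure_haarU : IsProbabilityMeasure haarU :=
  ⟨Measure.haarMeasure_self (K₀ := ⊤)⟩

instance isHaarMeasure_haarU : haarU.IsHaarMeasure := Measure.isHaarMeasure_haarMeasure _

/-- The operator `U^{⊗n} A (U^{⊗n})†`. -/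
noncomputable def conjTensor {n : ℕ} (U : unitaryGroup (Fin 2) ℂ)
    (A : Matrix (Fin n → Fin 2) (Fin n → Fin 2) ℂ) : Matrix (Fin n → Fin 2) (Fin n → Fin 2) ℂ :=
  tensorPow n (U : Matrix (Fin 2) (Fin 2) ℂ) * A * (tensorPow n (U : Matrix (Fin 2) (Fin 2) ℂ))ᴴ

theorem conjTensor_mul {n : ℕ} (U V : unitaryGroup (Fin 2) ℂ)
    (A : Matrix (Fin n → Fin 2) (Fin n → Fin 2) ℂ) :
    conjTensor (U * V) A = conjTensor U (conjTensor V A) := by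
  simp only [conjTensor, Submonoid.coe_mul, tensorPow_mul, conjTranspose_mul, Matrix.mul_assoc]

theorem integrable_conjTensor_apply {n : ℕ} (A : Matrix (Fin n → Fin 2) (Fin n → Fin 2) ℂ)
    (a b : Fin n → Fin 2) : Integrable (fun U => conjTensor U A a b) haarU := by
  refine Continuous.integrable_of_hasCompactSupport ?_ (HasCompactSupport.of_compactSpace _)
  have h := continuous_tensorPow n
  exact ((h.matrix_mul continuous_const).matrix_mul h.matrix_conjTranspose).matrix_elem a b

/-- The average of `U^{⊗n} A (U^{⊗n})†` over the Haar measure of `U(2)`, defined entrywise. -/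
noncomputable def twirl {n : ℕ} (A : Matrix (Fin n → Fin 2) (Fin n → Fin 2) ℂ) :
    Matrix (Fin n → Fin 2) (Fin n → Fin 2) ℂ :=
  Matrix.of fun a b => ∫ U, conjTensor U A a b ∂haarU

theorem twirl_apply {n : ℕ} (A : Matrix (Fin n → Fin 2) (Fin n → Fin 2) ℂ)
    (a b : Fin n → Fin 2) : twirl A a b = ∫ U, conjTensor U A a b ∂haarU := rfl

/-- Sesquilinear expressions in the entries commute with the average. -/
theorem integral_sum_sum_mul_conjTensor {n : ℕ} (A : Matrix (Fin n → Fin 2) (Fin n → Fin 2) ℂ)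
    (p q : (Fin n → Fin 2) → ℂ) :
    ∑ a, ∑ b, p a * twirl A a b * q b
      = ∫ U, ∑ a, ∑ b, p a * conjTensor U A a b * q b ∂haarU := by
  have hi : ∀ a b, Integrable (fun U => p a * conjTensor U A a b * q b) haarU :=
    fun a b => ((integrable_conjTensor_apply A a b).const_mul _).mul_const _
  rw [integral_finsetSum _ fun a _ => integrable_finsetSum _ fun b _ => hi a b]
  refine Finset.sum_congr rfl fun a _ => ?_
  rw [integral_finsetSum _ fun b _ => hi a b]
  refine Finset.sum_congr rfl fun b _ => ?_
  rw [integral_mul_const, integral_const_mul, twirl_apply]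

theorem mul_mul_apply_eq_sum {ι : Type*} [Fintype ι] (P A Q : Matrix ι ι ℂ) (a b : ι) :
    (P * A * Q) a b = ∑ c, ∑ d, P a c * A c d * Q d b := by
  simp only [Matrix.mul_apply, Finset.sum_mul]
  exact Finset.sum_comm

theorem conjTensor_twirl {n : ℕ} (V : unitaryGroup (Fin 2) ℂ)
    (A : Matrix (Fin n → Fin 2) (Fin n → Fin 2) ℂ) : conjTensor V (twirl A) = twirl A := by
  ext a b
  rw [conjTensor, mul_mul_apply_eq_sum, integral_sum_sum_mul_conjTensor, twirl_apply,
    ← integral_mul_left_eq_self (fun U => conjTensor U A a b) V]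
  refine integral_congr_ae (.of_forall fun U => ?_)
  exact (congrFun (congrFun (conjTensor_mul V U A) a) b).trans
    (mul_mul_apply_eq_sum _ _ _ a b) |>.symm

theorem tensorPow_commute_twirl {n : ℕ} (V : unitaryGroup (Fin 2) ℂ)
    (A : Matrix (Fin n → Fin 2) (Fin n → Fin 2) ℂ) :
    tensorPow n (V : Matrix (Fin 2) (Fin 2) ℂ) * twirl A
      = twirl A * tensorPow n (V : Matrix (Fin 2) (Fin 2) ℂ) := by
  conv_rhs => rw [← conjTensor_twirl V A]
  rw [conjTensor, Matrix.mul_assoc _ _ (tensorPow n _), tensorPow_conjTranspose_mul_self,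
    Matrix.mul_one]

theorem posSemidef_twirl {n : ℕ} {A : Matrix (Fin n → Fin 2) (Fin n → Fin 2) ℂ}
    (hA : A.PosSemidef) : (twirl A).PosSemidef := by
  have hU : ∀ U, (conjTensor U A).PosSemidef := fun U => hA.mul_mul_conjTranspose_same _
  refine .of_dotProduct_mulVec_nonneg ?_ fun v => ?_
  · ext a b
    rw [conjTranspose_apply, twirl_apply, twirl_apply, Complex.star_def, ← integral_conj]
    refine integral_congr_ae (.of_forall fun U => ?_)
    exact congrFun (congrFun (hU U).1 a) b
  · have h : ∀ B : Matrix (Fin n → Fin 2) (Fin n → Fin 2) ℂ,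
        star v ⬝ᵥ (B *ᵥ v) = ∑ a, ∑ b, star v a * B a b * v b := by
      intro B
      simp only [dotProduct, mulVec, Finset.mul_sum, mul_assoc]
    rw [h, integral_sum_sum_mul_conjTensor]
    refine integral_nonneg fun U => ?_
    rw [Pi.zero_apply, ← h]
    exact (hU U).dotProduct_mulVec_nonneg v

theorem trace_weightBlock_twirl_le_succ {n k : ℕ} (hk : 2 * k < n)
    {A : Matrix (Fin n → Fin 2) (Fin n → Fin 2) ℂ} (hA : A.PosSemidef) :
    (weightBlock k (twirl A)).trace ≤ (weightBlock (k + 1) (twirl A)).trace :=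
  trace_weightBlock_le_succ hk (posSemidef_twirl hA)
    (raising_commute fun V => tensorPow_commute_twirl V A)

theorem re_twirl_apply {n : ℕ} (A : Matrix (Fin n → Fin 2) (Fin n → Fin 2) ℂ)
    (x : Fin n → Fin 2) : (twirl A x x).re = ∫ U, (conjTensor U A x x).re ∂haarU :=
  (integral_re (integrable_conjTensor_apply A x x)).symm

/-! ### Output probabilities -/

theorem scrambledState_one {n : ℕ} (U : unitaryGroup (Fin 2) ℂ) (x : Fin n → Fin 2) :
    scrambledState 1 U x
      = tensorPow n (U : Matrix (Fin 2) (Fin 2) ℂ) *ᵥ basisKet x := by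
  have : qubitPerm (1 : Equiv.Perm (Fin n)) = 1 := by
    ext a b
    simp [qubitPerm, Matrix.one_apply, Equiv.Perm.one_def]
  rw [scrambledState, this, one_mulVec]

/-- The inverse of `U` appears because conjugating the operator by `U^{⊗n}` amounts to applying
`(U^{⊗n})†` to the state. -/
theorem dotProduct_scrambledState_inv {n : ℕ} (A : Matrix (Fin n → Fin 2) (Fin n → Fin 2) ℂ)
    (U : unitaryGroup (Fin 2) ℂ) (x : Fin n → Fin 2) :
    star (scrambledState 1 U⁻¹ x) ⬝ᵥ (A *ᵥ scrambledState 1 U⁻¹ x) = conjTensor U A x x := by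
  have hinv : ((U⁻¹ : unitaryGroup (Fin 2) ℂ) : Matrix (Fin 2) (Fin 2) ℂ)
      = (U : Matrix (Fin 2) (Fin 2) ℂ)ᴴ := rfl
  rw [scrambledState_one, hinv, tensorPow_conjTranspose, star_mulVec, conjTranspose_conjTranspose,
    ← dotProduct_mulVec, mulVec_mulVec, mulVec_mulVec, conjTensor]
  have hs : star (basisKet x) = Pi.single x (1 : ℂ) := by
    rw [basisKet, Pi.star_single, star_one]
  rw [hs, basisKet, single_one_dotProduct, mulVec_single_one]
  rfl

theorem MeasurementProcedure.prob_add_prob_le {n : ℕ} {Y : Type*} (M : MeasurementProcedure n Y)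
    {y z : Y} (hyz : y ≠ z) (ψ : (Fin n → Fin 2) → ℂ) :
    M.prob ψ y + M.prob ψ z ≤ (star ψ ⬝ᵥ ψ).re := by
  classical
  let φ : Matrix (Fin n → Fin 2) (Fin n → Fin 2) ℂ →+ ℝ :=
    { toFun := fun A => (star ψ ⬝ᵥ (A *ᵥ ψ)).re
      map_zero' := by simp
      map_add' := fun A B => by simp [add_mulVec, dotProduct_add] }
  have hφ : Continuous φ := by
    change Continuous fun A : Matrix (Fin n → Fin 2) (Fin n → Fin 2) ℂ =>
      (star ψ ⬝ᵥ (A *ᵥ ψ)).re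
    exact Complex.continuous_re.comp
      (continuous_const.dotProduct (continuous_id.matrix_mulVec continuous_const))
  have h : HasSum (fun y => M.prob ψ y) (φ 1) := M.hasSum_effect.map φ hφ
  have h1 : φ 1 = (star ψ ⬝ᵥ ψ).re := by
    change (star ψ ⬝ᵥ (1 *ᵥ ψ)).re = _
    rw [one_mulVec]
  rw [h1] at h
  have := sum_le_hasSum {y, z}
    (fun w _ => (Complex.nonneg_iff.1 ((M.posSemidef w).dotProduct_mulVec_nonneg ψ)).1) h
  rwa [Finset.sum_pair hyz] at this

theorem dotProduct_scrambledState_self {n : ℕ} (U : unitaryGroup (Fin 2) ℂ)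
    (x : Fin n → Fin 2) : star (scrambledState 1 U x) ⬝ᵥ scrambledState 1 U x = 1 := by
  rw [scrambledState_one, star_mulVec, ← dotProduct_mulVec, mulVec_mulVec,
    tensorPow_conjTranspose_mul_self, one_mulVec, basisKet, Pi.star_single, star_one,
    single_one_dotProduct, Pi.single_eq_same]

theorem theorem2 {n k : ℕ} {Y : Type*}
    (f : (Fin n → Fin 2) → Y) (F : ℕ → Y)
    (hf : ∀ x : Fin n → Fin 2, f x = F (hammingNorm x))
    (hk : k < n / 2) (hF : F (k + 1) ≠ F k)
    (M : MeasurementProcedure n Y) :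
    ∃ (x : Fin n → Fin 2) (U : Matrix.unitaryGroup (Fin 2) ℂ) (σ : Equiv.Perm (Fin n)),
      hammingNorm x ≤ n / 2 ∧
      M.prob (scrambledState σ U x) (f x) ≤ 1 - ((k : ℝ) + 1) / (2 * ((n : ℝ) - (k : ℝ))) := by
  by_contra! hcon
  set c : ℝ := 1 - ((k : ℝ) + 1) / (2 * ((n : ℝ) - (k : ℝ))) with hc
  set E := M.effect (F k) with hE
  have hprob : ∀ U x, (conjTensor U E x x).re = M.prob (scrambledState 1 U⁻¹ x) (F k) := by
    intro U x
    rw [← dotProduct_scrambledState_inv, MeasurementProcedure.prob]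
  have hint : ∀ x, Integrable (fun U => (conjTensor U E x x).re) haarU :=
    fun x => (integrable_conjTensor_apply E x x).re
  have hlow : ∀ x, hammingNorm x = k → c ≤ (twirl E x x).re := by
    intro x hx
    have h : ∀ U, c ≤ (conjTensor U E x x).re := by
      intro U
      rw [hprob, ← hx, ← hf]
      exact (hcon x U⁻¹ 1 (by omega)).le
    have := integral_mono (μ := haarU) (integrable_const c) (hint x) h
    rwa [integral_const, probReal_univ, one_smul, ← re_twirl_apply] at this
  have hupp : ∀ x, hammingNorm x = k + 1 → (twirl E x x).re ≤ 1 - c := by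
    intro x hx
    have h : ∀ U, (conjTensor U E x x).re ≤ 1 - c := by
      intro U
      have h1 := (hcon x U⁻¹ 1 (by omega)).le
      rw [hf, hx] at h1
      have h2 := M.prob_add_prob_le hF (scrambledState 1 U⁻¹ x)
      rw [dotProduct_scrambledState_self, Complex.one_re, ← hprob] at h2
      linarith
    have := integral_mono (μ := haarU) (hint x) (integrable_const (1 - c)) h
    rwa [integral_const, probReal_univ, one_smul, ← re_twirl_apply] at this
  have htr := (Complex.le_def.1
    (trace_weightBlock_twirl_le_succ (k := k) (by omega) (M.posSemidef (F k)))).1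
  rw [Matrix.trace, Matrix.trace, Complex.re_sum, Complex.re_sum] at htr
  have h1 : (n.choose k : ℝ) * c ≤ ∑ x, ((weightBlock k (twirl E)).diag x).re := by
    rw [← card_hammingNorm_eq n k, ← nsmul_eq_mul]
    exact Finset.card_nsmul_le_sum Finset.univ _ _ fun x _ => hlow x.1 x.2
  have h2 : ∑ x, ((weightBlock (k + 1) (twirl E)).diag x).re
      ≤ (n.choose (k + 1) : ℝ) * (1 - c) := by
    rw [← card_hammingNorm_eq n (k + 1), ← nsmul_eq_mul]
    exact Finset.sum_le_card_nsmul Finset.univ _ _ fun x _ => hupp x.1 x.2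
  have h3 : (n.choose k : ℝ) * c ≤ (n.choose (k + 1) : ℝ) * (1 - c) := h1.trans (htr.trans h2)
  have hkn : (k : ℝ) + 1 < (n : ℝ) - k := by
    have : 2 * k + 1 < n := by omega
    have : (2 * k + 1 : ℝ) < n := by exact_mod_cast this
    linarith
  have hd : (0 : ℝ) < (n : ℝ) - k := by
    have : (0 : ℝ) ≤ k := k.cast_nonneg
    linarith
  have hch : (n.choose (k + 1) : ℝ) * ((k : ℝ) + 1) = n.choose k * ((n : ℝ) - k) := by
    have := Nat.choose_succ_right_eq n k
    rw [← Nat.cast_sub (by omega : k ≤ n)]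
    exact_mod_cast this
  -- `1 - c` is half the ratio of the two binomial coefficients.
  have hch' : (n.choose (k + 1) : ℝ) * (1 - c) = n.choose k / 2 := by
    rw [hc, sub_sub_cancel, ← mul_div_assoc, hch]
    field_simp
  have hpos : (0 : ℝ) < n.choose k := by exact_mod_cast Nat.choose_pos (by omega)
  have hc2 : 1 / 2 < c := by
    have : ((k : ℝ) + 1) / (2 * ((n : ℝ) - (k : ℝ))) < 1 / 2 := by
      rw [div_lt_div_iff₀ (by linarith) two_pos]
      linarith
    rw [hc]
    linarith
  rw [hch'] at h3
  have := mul_lt_mul_of_pos_left hc2 hpos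
  linarith
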